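/- Let $K$ be an algebraically closed field, let $m,n\ge 0$, let $I\subset K[t_0,\dots,t_m]$ be a homogeneous prime ideal, and let $X=V(I)\subset\mathbb P^m_K$. Let $f_0,\dots,f_n\in K[t_0,\dots,t_m]$ be homogeneous of the same degree and not all vanishing identically on $X$ (so that $X\setminus V(f_0,\dots,f_n)\neq\emptyset$; in particular $X\ne\emptyset$), and let $$\Phi: X\dashrightarrow\mathbb P^n_K,\qquad t\mapsto (f_0(t):\dots:f_n(t))$$ be the rational map they define, that is, the class of this morphism on $X\setminus V(f_0,\dots,f_n)$ among all morphisms from non-empty open subsets of $X$ to $\mathbb P^n_K$, where two such morphisms are equivalent if they agree on the intersection of their domains. Let $D(\Phi)\subset X$ be the domain of definition of $\Phi$, i.e. the union of the domains of all morphisms in the class, and let $\operatorname{Im}(\Phi)\subset\mathbb P^n_K$ be the set of values of $\Phi$ on $D(\Phi)$. Put $$J=\left\langle I,\ \operatorname{minors}_2\begin{pmatrix}x_0&\cdots&x_n\\ f_0&\cdots&f_n\end{pmatrix}\right\rangle\subset K[t_0,\dots,t_m,x_0,\dots,x_n].$$ For ideals $A,B$ of a commutative ring $R$, write $A:B^\infty=\{a\in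 R\mid \exists N\in\mathbb N\ \forall b\in B:\ ab^N\in A\}$. Then the Zariski closure of the image is $$\overline{\operatorname{Im}(\Phi)}=V\big((J:\langle f_0,\dots,f_n\rangle^\infty)\cap K[x_0,\dots,x_n]\big)\subset\mathbb P^n_K.$$ Moreover, if $D(\Phi)=X$, then $\operatorname{Im}(\Phi)$ is Zariski closed. -/

import Mathlib

noncomputable section

namespace RatMap

open MvPolynomial

/-- Projective `n`-space over `K`: lines through the origin in `K^(n+1)`. -/
abbrev PSpace (K : Type*) [Field K] (n : ℕ) : Type _ := Projectivization K (Fin (n + 1) → K)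

section

variable {K : Type*} [Field K] {m n : ℕ}

/-- The polynomial `f` vanishes at every vector of homogeneous coordinates of `p`. For a homogeneous
`f` this is the usual condition `f(p) = 0`, and one vector of coordinates is enough. -/
def Vanishes (f : MvPolynomial (Fin (n + 1)) K) (p : PSpace K n) : Prop :=
  ∀ (v : Fin (n + 1) → K) (hv : v ≠ 0), Projectivization.mk K v hv = p → eval v f = 0

/-- The projective vanishing locus `V(S) ⊆ ℙⁿ`. -/
def projV (S : Set (MvPolynomial (Fin (n + 1)) K)) : Set (PSpace K n) :=
  {p | ∀ f ∈ S, Vanishes f p}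

/-- A set of homogeneous polynomials (of possibly different degrees). -/
def HomogSet (S : Set (MvPolynomial (Fin (n + 1)) K)) : Prop :=
  ∀ f ∈ S, ∃ d : ℕ, f.IsHomogeneous d

theorem eval_smul_of_homog {f : MvPolynomial (Fin (n + 1)) K} {d : ℕ} (hf : f.IsHomogeneous d)
    (c : K) (v : Fin (n + 1) → K) : eval (c • v) f = c ^ d * eval v f := by
  rw [eval_eq', eval_eq', Finset.mul_sum]
  refine Finset.sum_congr rfl fun s hs => ?_
  have h := hf.degree_eq_sum_deg_support hs
  have h2 : ∑ i, s i = d := by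
    rw [h]
    refine (Finset.sum_subset (Finset.subset_univ _) ?_).symm
    exact fun i _ hi => Finsupp.notMem_support_iff.1 hi
  simp only [Pi.smul_apply, smul_eq_mul, mul_pow, Finset.prod_mul_distrib,
    Finset.prod_pow_eq_pow_sum, h2]
  ring

theorem vanishes_mk_iff {f : MvPolynomial (Fin (n + 1)) K} {d : ℕ} (hf : f.IsHomogeneous d)
    (v : Fin (n + 1) → K) (hv : v ≠ 0) :
    Vanishes f (Projectivization.mk K v hv) ↔ eval v f = 0 := by
  refine ⟨fun h => h v hv rfl, fun h w hw hwv => ?_⟩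
  obtain ⟨a, rfl⟩ := (Projectivization.mk_eq_mk_iff' K w v hw hv).1 hwv
  rw [eval_smul_of_homog hf, h, mul_zero]

/-- The Zariski topology on `ℙⁿ`: the closed sets are the vanishing loci of sets of homogeneous
polynomials. -/
instance zariski : TopologicalSpace (PSpace K n) :=
  TopologicalSpace.ofClosed {Z | ∃ S, HomogSet S ∧ Z = projV S}
    ⟨{1}, fun f hf => ⟨0, by rw [Set.mem_singleton_iff.1 hf]; exact isHomogeneous_one _ _⟩, by
      refine (Set.eq_empty_iff_forall_notMem.2 fun p => ?_).symm
      induction p using Projectivization.ind with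
      | h v hv =>
        intro h
        simpa using h 1 rfl v hv rfl⟩
    (fun A hA => ⟨{f | (∃ d : ℕ, f.IsHomogeneous d) ∧ ∃ Z ∈ A, ∀ p ∈ Z, Vanishes f p},
      fun f hf => hf.1, by
        ext p
        refine ⟨fun hp f hf => ?_, fun hp Z hZ => ?_⟩
        · obtain ⟨_, Z, hZ, h⟩ := hf
          exact h p (hp Z hZ)
        · obtain ⟨S, hS, rfl⟩ := hA hZ
          exact fun f hf => hp f ⟨hS f hf, _, hZ, fun q hq => hq f hf⟩⟩)
    (by
      rintro _ ⟨S, hS, rfl⟩ _ ⟨T, hT, rfl⟩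
      refine ⟨{h | ∃ f ∈ S, ∃ g ∈ T, h = f * g}, ?_, ?_⟩
      · rintro _ ⟨f, hf, g, hg, rfl⟩
        obtain ⟨d, hd⟩ := hS f hf
        obtain ⟨e, he⟩ := hT g hg
        exact ⟨d + e, hd.mul he⟩
      · ext p
        induction p using Projectivization.ind with
        | h v hv =>
        constructor
        · rintro (h | h) _ ⟨f, hf, g, hg, rfl⟩ w hw hwv
          · rw [map_mul, h f hf w hw hwv, zero_mul]
          · rw [map_mul, h g hg w hw hwv, mul_zero]
        · intro h
          by_contra hcon
          rw [Set.mem_union, not_or] at hcon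
          obtain ⟨h1, h2⟩ := hcon
          simp only [projV, Set.mem_ofPred_eq, not_forall] at h1 h2
          obtain ⟨f, hf, h1⟩ := h1
          obtain ⟨g, hg, h2⟩ := h2
          obtain ⟨d, hd⟩ := hS f hf
          obtain ⟨e, he⟩ := hT g hg
          have h1' : eval v f ≠ 0 := fun h0 =>
            absurd ((vanishes_mk_iff hd v hv).2 h0) (by simpa [Vanishes] using h1)
          have h2' : eval v g ≠ 0 := fun h0 =>
            absurd ((vanishes_mk_iff he v hv).2 h0) (by simpa [Vanishes] using h2)
          have := h (f * g) ⟨f, hf, g, hg, rfl⟩ v hv rfl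
          rw [map_mul] at this
          exact (mul_ne_zero h1' h2') this)

theorem isClosed_iff {Z : Set (PSpace K n)} : IsClosed Z ↔ ∃ S, HomogSet S ∧ Z = projV S := by
  rw [← isOpen_compl_iff]
  change Zᶜᶜ ∈ _ ↔ _
  rw [compl_compl]
  rfl

/-- `φ` is a regular function on the quasi-projective set `U`: near each point of `U` it is a
quotient of two homogeneous polynomials of the same degree, the denominator being nowhere zero
there. Only the values of `φ` on `U` matter. -/
def IsRegularOn (U : Set (PSpace K n)) (φ : PSpace K n → K) : Prop :=
  ∀ p ∈ U, ∃ O : Set (PSpace K n), IsOpen O ∧ p ∈ O ∧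
    ∃ (d : ℕ) (g h : MvPolynomial (Fin (n + 1)) K), g.IsHomogeneous d ∧ h.IsHomogeneous d ∧
      ∀ (v : Fin (n + 1) → K) (hv : v ≠ 0), Projectivization.mk K v hv ∈ U ∩ O →
        eval v h ≠ 0 ∧ φ (Projectivization.mk K v hv) = eval v g / eval v h

/-- `F` is a morphism from the quasi-projective set `U ⊆ ℙᵐ` to `ℙⁿ`: it is continuous, and it pulls
regular functions on open subsets of `ℙⁿ` back to regular functions. Only the values of `F` on `U`
matter. -/
def IsMorphismOn (U : Set (PSpace K m)) (F : PSpace K m → PSpace K n) : Prop :=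
  ContinuousOn F U ∧
    ∀ W : Set (PSpace K n), IsOpen W → ∀ φ : PSpace K n → K, IsRegularOn W φ →
      IsRegularOn (U ∩ F ⁻¹' W) (φ ∘ F)

/-- A morphism from a non-empty open subset `dom` of `X ⊆ ℙᵐ` to `ℙⁿ`. The values of `toFun` outside
`dom` carry no meaning. -/
structure PartialMorphism (X : Set (PSpace K m)) (n : ℕ) where
  /-- The open subset on which the morphism is given. -/
  dom : Set (PSpace K m)
  /-- The morphism. -/
  toFun : PSpace K m → PSpace K n
  isOpen_dom : ∃ O : Set (PSpace K m), IsOpen O ∧ dom = X ∩ O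
  nonempty_dom : dom.Nonempty
  isMorphism : IsMorphismOn dom toFun

/-- Two partial morphisms define the same rational map if they agree where both are given. -/
def PartialMorphism.Equivalent {X : Set (PSpace K m)} (φ ψ : PartialMorphism X n) : Prop :=
  Set.EqOn φ.toFun ψ.toFun (φ.dom ∩ ψ.dom)

/-- The domain of definition of the rational map represented by `φ`: the union of the domains of all
the morphisms in its class. -/
def PartialMorphism.domainOfDefinition {X : Set (PSpace K m)} (φ : PartialMorphism X n) :
    Set (PSpace K m) :=
  {p | ∃ ψ : PartialMorphism X n, φ.Equivalent ψ ∧ p ∈ ψ.dom}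

/-- The set-theoretic image of the rational map represented by `φ`, that is, the set of its values
on its whole domain of definition. -/
def PartialMorphism.image {X : Set (PSpace K m)} (φ : PartialMorphism X n) : Set (PSpace K n) :=
  {q | ∃ ψ : PartialMorphism X n, φ.Equivalent ψ ∧ ∃ p ∈ ψ.dom, ψ.toFun p = q}

open Classical in
/-- The map `t ↦ (f₀(t) : … : fₙ(t))`, with a meaningless value where all the `fᵢ` vanish. -/
def formMap (f : Fin (n + 1) → MvPolynomial (Fin (m + 1)) K) (p : PSpace K m) : PSpace K n :=
  if h : (fun i => eval p.rep (f i)) ≠ 0 then Projectivization.mk K (fun i => eval p.rep (f i)) h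
  else Projectivization.mk K (fun _ => 1) (Function.ne_iff.2 ⟨0, one_ne_zero⟩)

theorem formMap_mk {f : Fin (n + 1) → MvPolynomial (Fin (m + 1)) K} {d : ℕ}
    (hf : ∀ i, (f i).IsHomogeneous d) (v : Fin (m + 1) → K) (hv : v ≠ 0)
    (h : (fun i => eval v (f i)) ≠ 0) :
    formMap f (Projectivization.mk K v hv) = Projectivization.mk K (fun i => eval v (f i)) h := by
  obtain ⟨a, ha⟩ := Projectivization.exists_smul_eq_mk_rep K v hv
  have key : (fun i => eval (Projectivization.mk K v hv).rep (f i)) =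
      ((a : K) ^ d) • fun i => eval v (f i) := by
    funext i
    rw [← ha, Units.smul_def, eval_smul_of_homog (hf i)]
    rfl
  have hne : (fun i => eval (Projectivization.mk K v hv).rep (f i)) ≠ 0 := by
    rw [key]
    exact smul_ne_zero (pow_ne_zero _ a.ne_zero) h
  rw [formMap, dif_pos hne, Projectivization.mk_eq_mk_iff']
  exact ⟨_, key.symm⟩

theorem eval_ne_zero_of_notMem {f : Fin (n + 1) → MvPolynomial (Fin (m + 1)) K} {d : ℕ}
    (hf : ∀ i, (f i).IsHomogeneous d) (v : Fin (m + 1) → K) (hv : v ≠ 0)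
    (h : Projectivization.mk K v hv ∉ projV (Set.range f)) : (fun i => eval v (f i)) ≠ 0 := by
  intro h0
  refine h ?_
  rintro _ ⟨i, rfl⟩
  exact (vanishes_mk_iff (hf i) v hv).2 (congrFun h0 i)

theorem isOpen_compl_projV {f : Fin (n + 1) → MvPolynomial (Fin (m + 1)) K} {d : ℕ}
    (hf : ∀ i, (f i).IsHomogeneous d) : IsOpen (projV (Set.range f))ᶜ := by
  rw [isOpen_compl_iff, isClosed_iff]
  refine ⟨_, ?_, rfl⟩
  rintro _ ⟨i, rfl⟩
  exact ⟨d, hf i⟩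

theorem eval_bind₁' (f : Fin (n + 1) → MvPolynomial (Fin (m + 1)) K) (v : Fin (m + 1) → K)
    (g : MvPolynomial (Fin (n + 1)) K) :
    eval v (bind₁ f g) = eval (fun i => eval v (f i)) g := by
  exact eval₂Hom_bind₁ (RingHom.id K) v f g

theorem bind₁_homog {f : Fin (n + 1) → MvPolynomial (Fin (m + 1)) K} {d : ℕ}
    (hf : ∀ i, (f i).IsHomogeneous d) {g : MvPolynomial (Fin (n + 1)) K} {e : ℕ}
    (hg : g.IsHomogeneous e) : (bind₁ f g).IsHomogeneous (d * e) :=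
  hg.aeval f hf

theorem preimage_formMap {f : Fin (n + 1) → MvPolynomial (Fin (m + 1)) K} {d : ℕ}
    (hf : ∀ i, (f i).IsHomogeneous d) {Z : Set (PSpace K n)} (hZ : IsClosed Z) :
    ∃ Z' : Set (PSpace K m), IsClosed Z' ∧
      ∀ p ∉ projV (Set.range f), formMap f p ∈ Z ↔ p ∈ Z' := by
  obtain ⟨S, hS, rfl⟩ := isClosed_iff.1 hZ
  refine ⟨projV ((fun g => bind₁ f g) '' S), isClosed_iff.2 ⟨_, ?_, rfl⟩, fun p hp => ?_⟩
  · rintro _ ⟨g, hg, rfl⟩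
    obtain ⟨e, he⟩ := hS g hg
    exact ⟨_, bind₁_homog hf he⟩
  · induction p using Projectivization.ind with
    | h v hv =>
    rw [formMap_mk hf v hv (eval_ne_zero_of_notMem hf v hv hp)]
    simp only [projV, Set.mem_ofPred_eq, Set.forall_mem_image]
    refine forall₂_congr fun g hg => ?_
    obtain ⟨e, he⟩ := hS g hg
    rw [vanishes_mk_iff he, vanishes_mk_iff (bind₁_homog hf he), eval_bind₁']

theorem isMorphismOn_formMap (X : Set (PSpace K m))
    {f : Fin (n + 1) → MvPolynomial (Fin (m + 1)) K} {d : ℕ}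
    (hf : ∀ i, (f i).IsHomogeneous d) :
    IsMorphismOn (X \ projV (Set.range f)) (formMap f) := by
  refine ⟨continuousOn_iff_isClosed.2 fun Z hZ => ?_, fun W hW φ hφ p hp => ?_⟩
  · obtain ⟨Z', hZ', h⟩ := preimage_formMap hf hZ
    refine ⟨Z', hZ', ?_⟩
    ext p
    exact and_congr_left fun hp => h p hp.2
  · obtain ⟨O, hO, hpO, e, g, k, hg, hk, h⟩ := hφ _ hp.2
    obtain ⟨Z', hZ', h'⟩ := preimage_formMap hf hO.isClosed_compl
    refine ⟨Z'ᶜ, hZ'.isOpen_compl, fun hpZ => (h' p hp.1.2).2 hpZ hpO, d * e, bind₁ f g,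
      bind₁ f k, bind₁_homog hf hg, bind₁_homog hf hk, fun v hv hvU => ?_⟩
    have hne := eval_ne_zero_of_notMem hf v hv hvU.1.1.2
    have hmem : formMap f (Projectivization.mk K v hv) ∈ W ∩ O :=
      ⟨hvU.1.2, by
        by_contra hcon
        exact hvU.2 ((h' _ hvU.1.1.2).1 hcon)⟩
    rw [formMap_mk hf v hv hne] at hmem
    rw [Function.comp_apply, formMap_mk hf v hv hne, eval_bind₁', eval_bind₁']
    exact h _ hne hmem

/-- The morphism `X ∖ V(f₀, …, fₙ) → ℙⁿ`, `t ↦ (f₀(t) : … : fₙ(t))`, given by forms of the same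
degree that do not all vanish on `X`. The rational map defined by the forms is its class. -/
def PartialMorphism.ofForms (X : Set (PSpace K m))
    (f : Fin (n + 1) → MvPolynomial (Fin (m + 1)) K) {d : ℕ} (hf : ∀ i, (f i).IsHomogeneous d)
    (hne : (X \ projV (Set.range f)).Nonempty) : PartialMorphism X n where
  dom := X \ projV (Set.range f)
  toFun := formMap f
  isOpen_dom := ⟨_, isOpen_compl_projV hf, rfl⟩
  nonempty_dom := hne
  isMorphism := isMorphismOn_formMap X hf

end

section

variable {R : Type*} [CommRing R]

/-- The saturation `I : 𝔟^∞ = {a | ∃ N, ∀ b ∈ 𝔟, a b^N ∈ I}`. -/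
def saturation (I B : Ideal R) : Ideal R where
  carrier := {a | ∃ N : ℕ, ∀ b ∈ B, a * b ^ N ∈ I}
  zero_mem' := ⟨0, fun b _ => by simp⟩
  add_mem' := by
    rintro a a' ⟨N, h⟩ ⟨N', h'⟩
    refine ⟨N + N', fun b hb => ?_⟩
    have e : (a + a') * b ^ (N + N') = b ^ N' * (a * b ^ N) + b ^ N * (a' * b ^ N') := by ring
    rw [e]
    exact I.add_mem (I.mul_mem_left _ (h b hb)) (I.mul_mem_left _ (h' b hb))
  smul_mem' := by
    rintro c a ⟨N, h⟩
    refine ⟨N, fun b hb => ?_⟩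
    rw [smul_eq_mul, mul_assoc]
    exact I.mul_mem_left _ (h b hb)

variable {m n : ℕ}

/-- The polynomial ring `K[t₀, …, tₘ, x₀, …, xₙ]`. -/
abbrev BiPoly (R : Type*) [CommRing R] (m n : ℕ) : Type _ :=
  MvPolynomial (Fin (m + 1) ⊕ Fin (n + 1)) R

/-- The inclusion `K[t₀, …, tₘ] → K[t₀, …, tₘ, x₀, …, xₙ]`. -/
def inclT : MvPolynomial (Fin (m + 1)) R →ₐ[R] BiPoly R m n := rename Sum.inl

/-- The inclusion `K[x₀, …, xₙ] → K[t₀, …, tₘ, x₀, …, xₙ]`. -/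
def inclX : MvPolynomial (Fin (n + 1)) R →ₐ[R] BiPoly R m n := rename Sum.inr

/-- The matrix with rows `(x₀, …, xₙ)` and `(f₀, …, fₙ)`. -/
def graphMatrix (f : Fin (n + 1) → MvPolynomial (Fin (m + 1)) R) :
    Matrix (Fin 2) (Fin (n + 1)) (BiPoly R m n) :=
  Matrix.of ![fun i => X (Sum.inr i), fun i => inclT (f i)]

/-- The `2 × 2` minors of a matrix with two rows. -/
def minors₂ {A : Type*} [CommRing A] (M : Matrix (Fin 2) (Fin (n + 1)) A) : Set A :=
  {a | ∃ i j : Fin (n + 1), i < j ∧ a = (M.submatrix id ![i, j]).det}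

/-- The ideal `J` of `K[t, x]` generated by `I` and the `2 × 2` minors of the matrix with rows `x`
and `f`. -/
def graphIdeal (I : Ideal (MvPolynomial (Fin (m + 1)) R))
    (f : Fin (n + 1) → MvPolynomial (Fin (m + 1)) R) : Ideal (BiPoly R m n) :=
  Ideal.span ((fun p => (inclT p : BiPoly R m n)) '' (I : Set (MvPolynomial (Fin (m + 1)) R)) ∪
    minors₂ (graphMatrix f))

/-- The ideal `(J : ⟨f₀, …, fₙ⟩^∞) ∩ K[x₀, …, xₙ]`. -/
def imageIdeal (I : Ideal (MvPolynomial (Fin (m + 1)) R))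
    (f : Fin (n + 1) → MvPolynomial (Fin (m + 1)) R) : Ideal (MvPolynomial (Fin (n + 1)) R) :=
  (saturation (graphIdeal I f)
    (Ideal.span (Set.range fun i => (inclT (f i) : BiPoly R m n)))).comap
      (inclX : MvPolynomial (Fin (n + 1)) R →ₐ[R] BiPoly R m n)

end

end RatMap

end

attribute [local instance] MvPolynomial.gradedAlgebra

/-! Modulo `I`, every tuple of forms `g` proportional to `f` defines the same rational map, and each
value of `Φ` is computed by such a tuple that does not vanish at the point
(`PartialMorphism.Equivalent.exists_forms`).

Closure: a form `G` vanishes on the image exactly when `G(f) ∈ I`, by the Nullstellensatz and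
primality of `I`. This in turn means that `G` lies in the image ideal. On the one hand, for `b ∈
⟨f⟩` the minors give `b xᵢ ≡ y fᵢ` modulo `J` for some `y`, so `b ^ e G(x) ≡ y ^ e G(f)`
(`mem_imageIdeal_of_bind₁_mem`). On the other hand, a substitution `x ↦ h` with `h` proportional to
`f` sends `J` into `I`, and some `fₖ ∉ I` can be cancelled (`bind₁_mem_of_mem_imageIdeal`).

Closedness: if `Φ` is defined everywhere on `X`, its image is the projection to `ℙⁿ` of the locus
where `x` is proportional to every tuple `g` as above. The tuple `f` alone would not do: over its
base points it imposes no condition on `x`. The projection is closed by elimination theory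
(`exists_eval_ne_zero_of_forall_eq_zero`), proved here with the Nullstellensatz and Nakayama's lemma
instead of resultants. -/

noncomputable section
namespace RatMap

open MvPolynomial

attribute [local instance] MvPolynomial.gradedAlgebra

/-! ### Elimination theory -/

section Elimination

variable {K σ τ : Type*} [Field K]

theorem mem_smul_homogeneousSubmodule {R : Type*} [CommRing R] (𝔪 : Ideal R) {N : ℕ}
    {F : MvPolynomial σ R} (hF : F.IsHomogeneous N) (hc : ∀ α, coeff α F ∈ 𝔪) :
    F ∈ 𝔪 • homogeneousSubmodule σ R N := by
  rw [F.as_sum]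
  refine Submodule.sum_mem _ fun α hα => ?_
  rw [← mul_one (coeff α F), ← smul_eq_mul, ← smul_monomial]
  refine Submodule.smul_mem_smul (hc α) ?_
  refine isHomogeneous_monomial _ ?_
  by_contra h
  exact mem_support_iff.1 hα (hF.coeff_eq_zero h)

/-- The set of parameters `w` for which a system of equations, homogeneous in `p`, has only the
trivial solution `p = 0`, is open. -/
theorem exists_eval_ne_zero_of_forall_eq_zero [IsAlgClosed K] [Finite σ]
    (S : Set (MvPolynomial σ (MvPolynomial τ K))) (hS : ∀ F ∈ S, ∃ d : ℕ, F.IsHomogeneous d)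
    (w : τ → K) (hw : ∀ p : σ → K, (∀ F ∈ S, eval p (map (eval w) F) = 0) → p = 0) :
    ∃ h : MvPolynomial τ K, eval w h ≠ 0 ∧ ∀ w' : τ → K, eval w' h ≠ 0 →
      ∀ p : σ → K, (∀ F ∈ S, eval p (map (eval w') F) = 0) → p = 0 := by
  classical
  set 𝔞 : Ideal (MvPolynomial σ (MvPolynomial τ K)) := Ideal.span S with h𝔞
  have hhom : 𝔞.IsHomogeneous (homogeneousSubmodule σ (MvPolynomial τ K)) :=
    Ideal.homogeneous_span _ _ fun F hF => hS F hF
  set φ : MvPolynomial σ (MvPolynomial τ K) →+* MvPolynomial σ K := map (eval w) with hφ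
  have hφs : Function.Surjective φ :=
    map_surjective _ fun c => ⟨C c, eval_C c⟩
  -- Nullstellensatz: the specialised system at `w` has no zero except possibly the origin, so its
  -- ideal contains a power of the irrelevant ideal.
  have hrad : idealOfVars σ K ≤ (𝔞.map φ).radical := by
    rw [idealOfVars, Ideal.span_le]
    rintro _ ⟨i, rfl⟩
    rw [← vanishingIdeal_zeroLocus_eq_radical (K := K)]
    intro p hp
    have : p = 0 := hw p fun F hF => by
      simpa [coe_aeval_eq_eval] using hp _ (Ideal.mem_map_of_mem φ (Ideal.subset_span hF))
    simp [this]
  obtain ⟨N, hN⟩ := Ideal.exists_pow_le_of_le_radical_of_fg hrad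
    (Submodule.fg_span (Set.finite_range _))
  set 𝔪 : Ideal (MvPolynomial τ K) := RingHom.ker (eval w) with h𝔪
  let q : MvPolynomial σ (MvPolynomial τ K) →ₗ[MvPolynomial τ K] _ :=
    (Ideal.Quotient.mkₐ (MvPolynomial τ K) 𝔞).toLinearMap
  have hq : ∀ F, q F = 0 ↔ F ∈ 𝔞 := fun F => Ideal.Quotient.eq_zero_iff_mem
  -- The degree `N` part `L` of the quotient by `𝔞` is a finite module over the parameter ring; this
  -- gives `L ≤ 𝔪 • L`, the hypothesis of Nakayama's lemma.
  have hmon : ∀ α : σ →₀ ℕ, α.degree = N →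
      q (monomial α 1) ∈ 𝔪 • (homogeneousSubmodule σ (MvPolynomial τ K) N).map q := by
    intro α hα
    have hαmem : monomial α (1 : K) ∈ 𝔞.map φ :=
      hN ((monomial_mem_pow_idealOfVars_iff N α one_ne_zero).2 hα.ge)
    obtain ⟨a, ha, haα⟩ := (Ideal.mem_map_iff_of_surjective φ hφs).1 hαmem
    -- Passing to degree `N` keeps the correction inside `𝔞`, which is homogeneous; the coefficients
    -- of `b` vanish at `w` because `a` specialises to the monomial.
    set b := homogeneousComponent N (monomial α 1 - a) with hb
    have hb' : b = monomial α 1 - homogeneousComponent N a := by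
      rw [hb, map_sub, homogeneousComponent_of_mem (isHomogeneous_monomial _ hα), if_pos rfl]
    have hqb : q (monomial α 1) = q b := by
      rw [← sub_eq_zero, ← map_sub, hq, hb', sub_sub_cancel]
      exact (mem_iff_homogeneousComponent_mem hhom a).1 ha N
    rw [hqb, ← Submodule.map_smul'']
    refine Submodule.mem_map_of_mem (mem_smul_homogeneousSubmodule 𝔪
      (homogeneousComponent_isHomogeneous _ _) fun β => ?_)
    rw [coeff_homogeneousComponent]
    split_ifs with hβ
    · rw [h𝔪, RingHom.mem_ker, ← coeff_map, ← hφ, map_sub, haα]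
      simp [hφ]
    · exact zero_mem _
  -- Nakayama's lemma: some `h ≡ 1` modulo `𝔪` annihilates `L`.
  obtain ⟨h, hh, hL⟩ := Submodule.exists_sub_one_mem_and_smul_eq_zero_of_fg_of_le_smul 𝔪
    ((homogeneousSubmodule σ (MvPolynomial τ K) N).map q)
    ((homogeneousSubmodule_fg σ (MvPolynomial τ K) N).map q) (by
      rintro _ ⟨F, hF, rfl⟩
      rw [F.as_sum, map_sum]
      refine Submodule.sum_mem _ fun α hα => ?_
      rw [← mul_one (coeff α F), ← smul_eq_mul, ← smul_monomial, map_smul]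
      refine Submodule.smul_mem _ _ (hmon α ?_)
      by_contra h
      exact mem_support_iff.1 hα (IsHomogeneous.coeff_eq_zero hF h))
  refine ⟨h, ?_, fun w' hw' p hp => ?_⟩
  · rw [h𝔪, RingHom.mem_ker, map_sub, map_one, sub_eq_zero] at hh
    rw [hh]
    exact one_ne_zero
  · funext i
    -- Evaluating `h • Xᵢ ^ N ∈ 𝔞` at a solution over `w'` yields `h(w') pᵢ ^ N = 0`.
    have hmem : h • (monomial (Finsupp.single i N) 1 : MvPolynomial σ (MvPolynomial τ K)) ∈ 𝔞 := by
      rw [← hq, map_smul]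
      exact hL _ (Submodule.mem_map_of_mem (isHomogeneous_monomial _ (by simp)))
    have hle : 𝔞 ≤ RingHom.ker ((eval p).comp (map (eval w'))) :=
      Ideal.span_le.2 fun F hF => hp F hF
    have := hle hmem
    simp only [RingHom.mem_ker, RingHom.comp_apply, smul_monomial, smul_eq_mul, mul_one,
      map_monomial, eval_monomial, Finsupp.prod_single_index, pow_zero, mul_eq_zero, hw',
      false_or] at this
    exact eq_zero_of_pow_eq_zero this

end Elimination

/-! ### Projective vanishing loci and the Nullstellensatz -/

variable {K : Type*} [Field K] {m n : ℕ}

/-- Along the line through `v`, `f` is a polynomial in `c` whose coefficients are the values at `v`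
of its homogeneous components, and it has infinitely many roots. -/
theorem eval_homogeneousComponent_eq_zero [Infinite K] {f : MvPolynomial (Fin (n + 1)) K}
    {v : Fin (n + 1) → K} (h : ∀ c : K, c ≠ 0 → eval (c • v) f = 0) (e : ℕ) :
    eval v (homogeneousComponent e f) = 0 := by
  classical
  set P : Polynomial K := ∑ i ∈ Finset.range (f.totalDegree + 1),
    Polynomial.monomial i (eval v (homogeneousComponent i f)) with hP
  have heval : ∀ c : K, P.eval c = eval (c • v) f := by
    intro c
    conv_rhs => rw [← sum_homogeneousComponent f]
    rw [hP, Polynomial.eval_finsetSum, map_sum]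
    refine Finset.sum_congr rfl fun i _ => ?_
    rw [Polynomial.eval_monomial, eval_smul_of_homog (homogeneousComponent_isHomogeneous i f),
      mul_comm]
  have hP0 : P = 0 := by
    refine Polynomial.eq_zero_of_infinite_isRoot P
      ((Set.infinite_univ.sdiff (Set.finite_singleton (0 : K))).mono fun c hc => ?_)
    exact (heval c).trans (h c hc.2)
  by_cases he : e ∈ Finset.range (f.totalDegree + 1)
  · have := congrArg (fun Q => Polynomial.coeff Q e) hP0
    simpa [hP, Polynomial.finsetSum_coeff, Polynomial.coeff_monomial, he] using this
  · rw [homogeneousComponent_eq_zero _ _ (by simpa [Nat.lt_succ_iff] using he), map_zero]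

theorem vanishes_mk_iff_forall_smul {f : MvPolynomial (Fin (n + 1)) K} (v : Fin (n + 1) → K)
    (hv : v ≠ 0) :
    Vanishes f (Projectivization.mk K v hv) ↔ ∀ c : K, c ≠ 0 → eval (c • v) f = 0 := by
  refine ⟨fun h c hc => h _ (smul_ne_zero hc hv)
    ((Projectivization.mk_eq_mk_iff' K _ _ _ _).2 ⟨c, rfl⟩), fun h w hw hwv => ?_⟩
  obtain ⟨a, rfl⟩ := (Projectivization.mk_eq_mk_iff' K w v hw hv).1 hwv
  exact h a fun ha => hw (by rw [ha, zero_smul])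

/-- Over an infinite field, the locus where arbitrary polynomials vanish at all vectors of
homogeneous coordinates is Zariski closed. -/
theorem isClosed_projV [Infinite K] (S : Set (MvPolynomial (Fin (n + 1)) K)) :
    IsClosed (projV S) := by
  refine isClosed_iff.2 ⟨{g | ∃ f ∈ S, ∃ e, g = homogeneousComponent e f}, ?_, ?_⟩
  · rintro _ ⟨f, -, e, rfl⟩
    exact ⟨e, homogeneousComponent_isHomogeneous e f⟩
  · ext p
    induction p using Projectivization.ind with
    | h v hv =>
    constructor
    · rintro h _ ⟨f, hf, e, rfl⟩
      rw [vanishes_mk_iff (homogeneousComponent_isHomogeneous e f)]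
      exact eval_homogeneousComponent_eq_zero ((vanishes_mk_iff_forall_smul v hv).1 (h f hf)) e
    · intro h f hf w hw hwv
      rw [← sum_homogeneousComponent f, map_sum]
      exact Finset.sum_eq_zero fun e _ => h _ ⟨f, hf, e, rfl⟩ w hw hwv

theorem mk_mem_projV_iff {I : Ideal (MvPolynomial (Fin (m + 1)) K)}
    (hI : I.IsHomogeneous (homogeneousSubmodule (Fin (m + 1)) K))
    (v : Fin (m + 1) → K) (hv : v ≠ 0) :
    Projectivization.mk K v hv ∈ projV (I : Set (MvPolynomial (Fin (m + 1)) K)) ↔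
      ∀ f ∈ I, eval v f = 0 := by
  refine ⟨fun h f hf => h f hf v hv rfl, fun h f hf w hw hwv => ?_⟩
  rw [← sum_homogeneousComponent f, map_sum]
  refine Finset.sum_eq_zero fun e _ => ?_
  exact (vanishes_mk_iff (homogeneousComponent_isHomogeneous e f) v hv).2
    (h _ ((mem_iff_homogeneousComponent_mem hI f).1 hf e)) w hw hwv

/-- The affine Nullstellensatz applied to the cone over `X`; primality makes `I` equal to its
radical. -/
theorem mem_of_forall_eval_eq_zero [IsAlgClosed K] {I : Ideal (MvPolynomial (Fin (m + 1)) K)}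
    (hI : I.IsPrime) (hX : (projV (I : Set (MvPolynomial (Fin (m + 1)) K))).Nonempty)
    {r : MvPolynomial (Fin (m + 1)) K} {e : ℕ} (hr : r.IsHomogeneous e)
    (h : ∀ v : Fin (m + 1) → K, v ≠ 0 → (∀ f ∈ I, eval v f = 0) → eval v r = 0) : r ∈ I := by
  rw [← IsPrime.vanishingIdeal_zeroLocus (K := K) I (h := hI)]
  intro v hv
  change ∀ p ∈ I, eval v p = 0 at hv
  change eval v r = 0
  -- The vertex of the cone is no projective point. Its value is reached by scaling a vector `u`
  -- over a point of `X` by `0`, which also covers constant forms; hence `X` must be non-empty.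
  by_cases hv0 : v = 0
  · obtain ⟨p, hp⟩ := hX
    induction p using Projectivization.ind with
    | h u hu =>
    rw [hv0, ← zero_smul K u, eval_smul_of_homog hr, h u hu fun f hf => hp f hf u hu rfl, mul_zero]
  · exact h v hv0 hv

/-- Among the forms cutting out the complement of `O`, one is non-zero at `v`. -/
theorem exists_homogeneous_of_isOpen {O : Set (PSpace K m)} (hO : IsOpen O)
    {v : Fin (m + 1) → K} {hv : v ≠ 0} (hvO : Projectivization.mk K v hv ∈ O) :
    ∃ (e : ℕ) (s : MvPolynomial (Fin (m + 1)) K), s.IsHomogeneous e ∧ eval v s ≠ 0 ∧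
      ∀ (u : Fin (m + 1) → K) (hu : u ≠ 0), Projectivization.mk K u hu ∉ O → eval u s = 0 := by
  obtain ⟨S, hS, hSO⟩ := isClosed_iff.1 hO.isClosed_compl
  by_contra! hcon
  refine (hSO.symm ▸ (fun s hs => ?_ : Projectivization.mk K v hv ∈ projV S) :
    Projectivization.mk K v hv ∈ Oᶜ) hvO
  obtain ⟨e, he⟩ := hS s hs
  rw [vanishes_mk_iff he]
  by_contra hne
  obtain ⟨u, hu, huO, hus⟩ := hcon e s he hne
  have : Projectivization.mk K u hu ∈ projV S := hSO ▸ huO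
  exact hus (this s hs u hu rfl)

/-- A form that vanishes on a non-empty open subset of `V(I)`, `I` a prime ideal, lies in `I`. -/
theorem mem_of_forall_eval_eq_zero_of_isOpen [IsAlgClosed K]
    {I : Ideal (MvPolynomial (Fin (m + 1)) K)} (hI : I.IsPrime) {O : Set (PSpace K m)}
    (hO : IsOpen O) (hne : (projV (I : Set (MvPolynomial (Fin (m + 1)) K)) ∩ O).Nonempty)
    {r : MvPolynomial (Fin (m + 1)) K} {e : ℕ} (hr : r.IsHomogeneous e)
    (h : ∀ (v : Fin (m + 1) → K) (hv : v ≠ 0), (∀ f ∈ I, eval v f = 0) →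
      Projectivization.mk K v hv ∈ O → eval v r = 0) : r ∈ I := by
  obtain ⟨p, hpX, hpO⟩ := hne
  induction p using Projectivization.ind with
  | h v hv =>
  obtain ⟨e', s, hs, hsv, hsO⟩ := exists_homogeneous_of_isOpen hO hpO
  -- The factor `s` kills the points outside `O`; it is not in `I`, so it can be cancelled.
  have hmem : s * r ∈ I := by
    refine mem_of_forall_eval_eq_zero hI ⟨_, hpX⟩ (hs.mul hr) fun u hu huI => ?_
    rw [map_mul]
    by_cases huO : Projectivization.mk K u hu ∈ O
    · rw [h u hu huI huO, mul_zero]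
    · rw [hsO u hu huO, zero_mul]
  exact (hI.mem_or_mem hmem).resolve_left fun hsI => hsv (hpX s hsI v hv rfl)

/-! ### Local description of morphisms to projective space -/

theorem mk_eq_mk_iff_forall_mul_eq {a b : Fin (n + 1) → K} (ha : a ≠ 0) (hb : b ≠ 0) :
    Projectivization.mk K a ha = Projectivization.mk K b hb ↔
      ∀ i j, a i * b j = a j * b i := by
  rw [Projectivization.mk_eq_mk_iff']
  constructor
  · rintro ⟨c, rfl⟩ i j
    simp only [Pi.smul_apply, smul_eq_mul]
    ring
  · intro h
    obtain ⟨j, hj⟩ := Function.ne_iff.1 hb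
    refine ⟨a j / b j, funext fun i => ?_⟩
    rw [Pi.smul_apply, smul_eq_mul, div_mul_eq_mul_div, div_eq_iff hj, h]

theorem isRegularOn_div (i j : Fin (n + 1)) :
    IsRegularOn (projV {(X j : MvPolynomial (Fin (n + 1)) K)})ᶜ (fun q => q.rep i / q.rep j) := by
  refine fun p _ => ⟨Set.univ, isOpen_univ, trivial, 1, X i, X j, isHomogeneous_X _ _,
    isHomogeneous_X _ _, fun v hv hvU => ?_⟩
  have hvj : v j ≠ 0 := fun h0 => hvU.1 <| by
    rintro _ rfl
    exact (vanishes_mk_iff (isHomogeneous_X _ _) v hv).2 (by simpa using h0)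
  obtain ⟨a, ha⟩ := Projectivization.exists_smul_eq_mk_rep K v hv
  simp only [eval_X, ← ha, Pi.smul_apply, Units.smul_def, smul_eq_mul]
  exact ⟨hvj, mul_div_mul_left _ _ a.ne_zero⟩

/-- Locally, a morphism to projective space is given by forms of the same degree without a common
zero. -/
theorem IsMorphismOn.exists_forms {U : Set (PSpace K m)} {F : PSpace K m → PSpace K n}
    (hF : IsMorphismOn U F) {p : PSpace K m} (hp : p ∈ U) :
    ∃ O : Set (PSpace K m), IsOpen O ∧ p ∈ O ∧
      ∃ (e : ℕ) (g : Fin (n + 1) → MvPolynomial (Fin (m + 1)) K), (∀ i, (g i).IsHomogeneous e) ∧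
        ∀ (u : Fin (m + 1) → K) (hu : u ≠ 0), Projectivization.mk K u hu ∈ U ∩ O →
          ∃ hne : (fun i => eval u (g i)) ≠ 0,
            F (Projectivization.mk K u hu) = Projectivization.mk K (fun i => eval u (g i)) hne := by
  classical
  obtain ⟨j, hj⟩ := Function.ne_iff.1 (F p).rep_nonzero
  set W : Set (PSpace K n) := (projV {(X j : MvPolynomial (Fin (n + 1)) K)})ᶜ with hW
  have hWo : IsOpen W := by
    rw [hW, isOpen_compl_iff, isClosed_iff]
    refine ⟨_, ?_, rfl⟩
    rintro _ rfl
    exact ⟨1, isHomogeneous_X _ _⟩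
  have hmemW : ∀ q : PSpace K n, q ∈ W ↔ q.rep j ≠ 0 := by
    intro q
    have := vanishes_mk_iff (isHomogeneous_X K j) q.rep q.rep_nonzero
    rw [q.mk_rep, eval_X] at this
    simp [hW, projV, this]
  obtain ⟨O', hO', hO'W⟩ := continuousOn_iff'.1 hF.1 W hWo
  have hpW : p ∈ U ∩ F ⁻¹' W := ⟨hp, (hmemW _).2 hj⟩
  choose O hO hpO dg a b ha hb hab using
    fun i => hF.2 W hWo _ (isRegularOn_div i j) p hpW
  -- The pulled-back coordinate functions `xᵢ / xⱼ` are locally `aᵢ / bᵢ`. Multiplying by the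
  -- product of all `bₖ` clears denominators and gives all the forms the common degree `∑ dg i`.
  refine ⟨O' ∩ ⋂ i, O i, hO'.inter (isOpen_iInter_of_finite hO),
    ⟨(hO'W.subset ⟨hpW.2, hp⟩).1, Set.mem_iInter.2 hpO⟩, ∑ i, dg i,
    fun i => a i * ∏ k ∈ Finset.univ.erase i, b k, fun i => ?_, fun u hu huU => ?_⟩
  · rw [← Finset.add_sum_erase _ _ (Finset.mem_univ i)]
    exact (ha i).mul (IsHomogeneous.prod _ _ _ fun k _ => hb k)
  · have huW : Projectivization.mk K u hu ∈ U ∩ F ⁻¹' W :=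
      ⟨huU.1, (hO'W.superset ⟨huU.2.1, huU.1⟩).1⟩
    have hab' := fun i => hab i u hu ⟨huW, Set.mem_iInter.1 huU.2.2 i⟩
    set q := F (Projectivization.mk K u hu) with hq
    have hqj : q.rep j ≠ 0 := (hmemW _).1 huW.2
    have hB : ∏ k, eval u (b k) ≠ 0 := Finset.prod_ne_zero_iff.2 fun k _ => (hab' k).1
    have key : (fun i => eval u (a i * ∏ k ∈ Finset.univ.erase i, b k)) =
        ((∏ k, eval u (b k)) / q.rep j) • q.rep := by
      funext i
      have h2 : q.rep i / q.rep j = eval u (a i) / eval u (b i) := (hab' i).2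
      rw [Pi.smul_apply, smul_eq_mul, div_mul_eq_mul_div, mul_div_assoc, h2, map_mul, map_prod,
        ← Finset.mul_prod_erase _ _ (Finset.mem_univ i)]
      field_simp [(hab' i).1]
    have hne : (fun i => eval u (a i * ∏ k ∈ Finset.univ.erase i, b k)) ≠ 0 := by
      rw [key]
      exact smul_ne_zero (div_ne_zero hB hqj) q.rep_nonzero
    refine ⟨hne, ?_⟩
    conv_lhs => rw [← q.mk_rep]
    exact ((Projectivization.mk_eq_mk_iff' K _ _ _ _).2 ⟨_, key.symm⟩).symm

/-! ### Tuples of forms representing the rational map -/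

/-- The forms `g₀, …, gₙ` have the same degree and are proportional to `f₀, …, fₙ` modulo `I`. -/
def IsProportional (I : Ideal (MvPolynomial (Fin (m + 1)) K))
    (f g : Fin (n + 1) → MvPolynomial (Fin (m + 1)) K) : Prop :=
  (∃ e : ℕ, ∀ i, (g i).IsHomogeneous e) ∧ ∀ i j, g i * f j - g j * f i ∈ I

theorem exists_notMem {I : Ideal (MvPolynomial (Fin (m + 1)) K)}
    {f : Fin (n + 1) → MvPolynomial (Fin (m + 1)) K}
    (hne : (projV (I : Set (MvPolynomial (Fin (m + 1)) K)) \ projV (Set.range f)).Nonempty) :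
    ∃ i, f i ∉ I := by
  by_contra! h
  obtain ⟨p, hpX, hpf⟩ := hne
  refine hpf ?_
  rintro _ ⟨i, rfl⟩
  exact hpX _ (h i)

/-- Over the fraction field of `K[t]/I` both tuples are multiples of the non-zero vector `f`.
Without denominators: multiply the minor by `fₖ²` and cancel by primality. -/
theorem IsProportional.mul_sub_mul_mem {I : Ideal (MvPolynomial (Fin (m + 1)) K)}
    (hI : I.IsPrime) {f g h : Fin (n + 1) → MvPolynomial (Fin (m + 1)) K} (hf : ∃ i, f i ∉ I)
    (hg : IsProportional I f g) (hh : IsProportional I f h) (i j : Fin (n + 1)) :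
    g i * h j - g j * h i ∈ I := by
  obtain ⟨k, hk⟩ := hf
  have e : (g i * h j - g j * h i) * (f k * f k) =
      (g i * f k - g k * f i) * (h j * f k) + (h j * f k - h k * f j) * (g k * f i) -
        ((g j * f k - g k * f j) * (h i * f k) + (h i * f k - h k * f i) * (g k * f j)) := by
    ring
  have : (g i * h j - g j * h i) * (f k * f k) ∈ I := by
    rw [e]
    exact I.sub_mem (I.add_mem (I.mul_mem_right _ (hg.2 _ _)) (I.mul_mem_right _ (hh.2 _ _)))
      (I.add_mem (I.mul_mem_right _ (hg.2 _ _)) (I.mul_mem_right _ (hh.2 _ _)))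
  exact (hI.mem_or_mem this).resolve_right fun h' => (hI.mem_or_mem h').elim hk hk

/-- Each value of the rational map defined by `f₀, …, fₙ` is given by forms proportional to
`f₀, …, fₙ` modulo `I`. -/
theorem PartialMorphism.Equivalent.exists_forms [IsAlgClosed K]
    {I : Ideal (MvPolynomial (Fin (m + 1)) K)} (hI : I.IsPrime)
    (hIhom : I.IsHomogeneous (homogeneousSubmodule (Fin (m + 1)) K))
    {f : Fin (n + 1) → MvPolynomial (Fin (m + 1)) K} {d : ℕ} (hf : ∀ i, (f i).IsHomogeneous d)
    (hne : (projV (I : Set (MvPolynomial (Fin (m + 1)) K)) \ projV (Set.range f)).Nonempty)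
    {ψ : PartialMorphism (projV (I : Set (MvPolynomial (Fin (m + 1)) K))) n}
    (hψ : (PartialMorphism.ofForms _ f hf hne).Equivalent ψ)
    {v : Fin (m + 1) → K} {hv : v ≠ 0} (hp : Projectivization.mk K v hv ∈ ψ.dom) :
    ∃ g : Fin (n + 1) → MvPolynomial (Fin (m + 1)) K, IsProportional I f g ∧
      ∃ hg : (fun i => eval v (g i)) ≠ 0,
        ψ.toFun (Projectivization.mk K v hv) = Projectivization.mk K (fun i => eval v (g i)) hg := by
  obtain ⟨O, hO, hpO, e, g, hge, hg⟩ := ψ.isMorphism.exists_forms hp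
  obtain ⟨O', hO', hdom⟩ := ψ.isOpen_dom
  refine ⟨g, ⟨⟨e, hge⟩, fun i j => ?_⟩, hg v hv ⟨hp, hpO⟩⟩
  obtain ⟨k, hk⟩ := exists_notMem hne
  have hpX : Projectivization.mk K v hv ∈ projV (I : Set _) ∩ O' := hdom ▸ hp
  -- Where `fₖ ≠ 0`, both tuples compute the same point, so the minor vanishes; the factor `fₖ`
  -- takes care of the remaining points.
  have hmem : f k * (g i * f j - g j * f i) ∈ I := by
    refine mem_of_forall_eval_eq_zero_of_isOpen hI (hO'.inter hO) ⟨_, hpX.1, hpX.2, hpO⟩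
      ((hf k).mul (((hge i).mul (hf j)).sub ((hge j).mul (hf i)))) fun u hu huI huO => ?_
    rw [map_mul]
    by_cases hku : eval u (f k) = 0
    · rw [hku, zero_mul]
    · have hfu : (fun i => eval u (f i)) ≠ 0 := Function.ne_iff.2 ⟨k, hku⟩
      have huf : Projectivization.mk K u hu ∉ projV (Set.range f) := fun h =>
        hku (h _ ⟨k, rfl⟩ u hu rfl)
      have huX := (mk_mem_projV_iff hIhom u hu).2 huI
      have hudom : Projectivization.mk K u hu ∈ ψ.dom := hdom ▸ ⟨huX, huO.1⟩
      obtain ⟨hgu, hval⟩ := hg u hu ⟨hudom, huO.2⟩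
      have heq : formMap f (Projectivization.mk K u hu) = ψ.toFun (Projectivization.mk K u hu) :=
        hψ ⟨⟨huX, huf⟩, hudom⟩
      rw [formMap_mk hf u hu hfu, hval, mk_eq_mk_iff_forall_mul_eq] at heq
      rw [map_sub, map_mul, map_mul]
      linear_combination (-eval u (f k)) * heq i j
  exact (hI.mem_or_mem hmem).resolve_left hk

/-! ### The image ideal -/

theorem aeval_mul_of_homog {A : Type*} [CommRing A] [Algebra K A] {g : MvPolynomial (Fin (n + 1)) K}
    {e : ℕ} (hg : g.IsHomogeneous e) (c : A) (y : Fin (n + 1) → A) :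
    aeval (fun i => c * y i) g = c ^ e * aeval y g := by
  rw [aeval_def, aeval_def, eval₂_eq', eval₂_eq', Finset.mul_sum]
  refine Finset.sum_congr rfl fun s hs => ?_
  have h2 : ∑ i, s i = e := by
    rw [← Finsupp.degree_eq_sum]
    by_contra h
    exact mem_support_iff.1 hs (hg.coeff_eq_zero h)
  simp only [mul_pow, Finset.prod_mul_distrib, Finset.prod_pow_eq_pow_sum, h2]
  ring

theorem minor_mem_graphIdeal (I : Ideal (MvPolynomial (Fin (m + 1)) K))
    (f : Fin (n + 1) → MvPolynomial (Fin (m + 1)) K) (i j : Fin (n + 1)) :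
    X (Sum.inr i) * inclT (f j) - X (Sum.inr j) * inclT (f i) ∈ graphIdeal I f := by
  have key : ∀ i j : Fin (n + 1), i < j →
      X (Sum.inr i) * inclT (f j) - X (Sum.inr j) * inclT (f i) ∈ graphIdeal I f :=
    fun i j hij => Ideal.subset_span <| Or.inr ⟨i, j, hij, by
      simp [Matrix.det_fin_two, graphMatrix]⟩
  rcases lt_trichotomy i j with h | rfl | h
  · exact key i j h
  · rw [sub_self]
    exact zero_mem _
  · rw [← neg_sub]
    exact neg_mem (key j i h)

/-- The saturation exponent can be taken to be the degree of `g`: modulo `J`, `b ^ e g(x) = g(b x) =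
g(y f) = y ^ e g(f) = 0`. -/
theorem mem_imageIdeal_of_bind₁_mem {I : Ideal (MvPolynomial (Fin (m + 1)) K)}
    {f : Fin (n + 1) → MvPolynomial (Fin (m + 1)) K} {g : MvPolynomial (Fin (n + 1)) K} {e : ℕ}
    (hg : g.IsHomogeneous e) (h : bind₁ f g ∈ I) : g ∈ imageIdeal I f := by
  refine ⟨e, fun b hb => ?_⟩
  -- For `b = ∑ cₖ fₖ` the witness is `y = ∑ cₖ xₖ`; the minors give the congruence on generators,
  -- and it is linear in `b`.
  obtain ⟨y, hy⟩ : ∃ y : BiPoly K m n, ∀ i,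
      b * X (Sum.inr i) - y * inclT (f i) ∈ graphIdeal I f := by
    induction hb using Submodule.span_induction with
    | mem b hb =>
      obtain ⟨k, rfl⟩ := hb
      refine ⟨X (Sum.inr k), fun i => ?_⟩
      rw [mul_comm]
      exact minor_mem_graphIdeal I f i k
    | zero => exact ⟨0, fun i => by simp⟩
    | add b b' _ _ h h' =>
      obtain ⟨y, hy⟩ := h
      obtain ⟨y', hy'⟩ := h'
      refine ⟨y + y', fun i => ?_⟩
      rw [add_mul, add_mul, add_sub_add_comm]
      exact add_mem (hy i) (hy' i)
    | smul c b _ h =>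
      obtain ⟨y, hy⟩ := h
      refine ⟨c * y, fun i => ?_⟩
      rw [smul_eq_mul, mul_assoc, mul_assoc, ← mul_sub]
      exact Ideal.mul_mem_left _ _ (hy i)
  let π := Ideal.Quotient.mkₐ K (graphIdeal I f)
  have hπ : ∀ a, a ∈ graphIdeal I f ↔ π a = 0 := fun a => Ideal.Quotient.eq_zero_iff_mem.symm
  have hx : ∀ a, π (inclX a) = aeval (fun i => π (X (Sum.inr i))) a := by
    intro a
    rw [inclX, ← aeval_X_left_apply (R := K) (rename Sum.inr a), aeval_rename,
      ← comp_aeval_apply]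
    rfl
  have ht : π (inclT (bind₁ f g)) = aeval (fun i => π (inclT (f i))) g := by
    exact comp_aeval_apply _ (π.comp inclT) g
  change inclX g * b ^ e ∈ graphIdeal I f
  rw [hπ, map_mul, map_pow, hx, mul_comm, ← aeval_mul_of_homog hg]
  have hfun : (fun i => π b * π (X (Sum.inr i))) = fun i => π y * π (inclT (f i)) := by
    funext i
    rw [← sub_eq_zero, ← map_mul, ← map_mul, ← map_sub, ← hπ]
    exact hy i
  rw [hfun, aeval_mul_of_homog hg, ← ht, (hπ (inclT _)).1, mul_zero]
  exact Ideal.subset_span (Or.inl ⟨_, h, rfl⟩)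

/-- Substituting `x ↦ h` turns the minors into elements of `I`, so `fₖ ^ N g(h) ∈ I`, and `fₖ ∉ I`
cancels. Neither `g` nor `h` need be homogeneous. -/
theorem bind₁_mem_of_mem_imageIdeal {I : Ideal (MvPolynomial (Fin (m + 1)) K)} (hI : I.IsPrime)
    {f : Fin (n + 1) → MvPolynomial (Fin (m + 1)) K} (hf : ∃ i, f i ∉ I)
    {g : MvPolynomial (Fin (n + 1)) K} (hg : g ∈ imageIdeal I f)
    {h : Fin (n + 1) → MvPolynomial (Fin (m + 1)) K} (hh : ∀ i j, h i * f j - h j * f i ∈ I) :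
    bind₁ h g ∈ I := by
  obtain ⟨k, hk⟩ := hf
  obtain ⟨N, hN⟩ := hg
  let θ : BiPoly K m n →ₐ[K] MvPolynomial (Fin (m + 1)) K := aeval (Sum.elim X h)
  have hθT : ∀ a, θ (inclT a) = a := fun a => by
    simp only [θ, inclT, aeval_rename, Sum.elim_comp_inl, aeval_X_left_apply]
  have hθX : ∀ a, θ (inclX a) = bind₁ h a := fun a => by
    simp only [θ, inclX, aeval_rename, Sum.elim_comp_inr]
    rfl
  have hle : graphIdeal I f ≤ I.comap θ := by
    refine Ideal.span_le.2 ?_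
    rintro _ (⟨a, ha, rfl⟩ | ⟨i, j, -, rfl⟩)
    · simpa [hθT] using ha
    · have hθ : θ ((graphMatrix f).submatrix id ![i, j]).det = h i * f j - h j * f i := by
        simp only [Matrix.det_fin_two, graphMatrix, Matrix.submatrix_apply, Matrix.of_apply,
          Matrix.cons_val_zero, Matrix.cons_val_one, id_eq, map_sub, map_mul, hθT]
        simp only [θ, aeval_X, Sum.elim_inr]
      exact (congrArg (· ∈ I) hθ).mpr (hh i j)
  have := hle (hN _ (Ideal.subset_span ⟨k, rfl⟩))
  rw [Ideal.mem_comap, map_mul, map_pow, hθT] at this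
  exact hθX g ▸ (hI.mem_or_mem this).resolve_right fun h' => hk (hI.mem_of_pow_mem _ h')

/-! ### Closure and closedness of the image -/

section

variable {I : Ideal (MvPolynomial (Fin (m + 1)) K)}
  {f : Fin (n + 1) → MvPolynomial (Fin (m + 1)) K} {d : ℕ}

/-- Equations, with coefficients in `K[x₀, …, xₙ]`, of the graph of the rational map defined by
`f₀, …, fₙ`. -/
def graphEquations (I : Ideal (MvPolynomial (Fin (m + 1)) K))
    (f : Fin (n + 1) → MvPolynomial (Fin (m + 1)) K) :
    Set (MvPolynomial (Fin (m + 1)) (MvPolynomial (Fin (n + 1)) K)) :=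
  {F | ∃ a ∈ I, (∃ e : ℕ, a.IsHomogeneous e) ∧ F = map C a} ∪
    {F | ∃ g, IsProportional I f g ∧ ∃ i j,
      F = C (X i) * map C (g j) - C (X j) * map C (g i)}

theorem isHomogeneous_of_mem_graphEquations
    {F : MvPolynomial (Fin (m + 1)) (MvPolynomial (Fin (n + 1)) K)}
    (hF : F ∈ graphEquations I f) : ∃ e : ℕ, F.IsHomogeneous e := by
  rcases hF with ⟨a, -, ⟨e, he⟩, rfl⟩ | ⟨g, ⟨⟨e, he⟩, -⟩, i, j, rfl⟩
  · exact ⟨e, he.map _⟩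
  · exact ⟨e, (((he j).map _).C_mul _).sub (((he i).map _).C_mul _)⟩

theorem forall_graphEquations_iff (hIhom : I.IsHomogeneous (homogeneousSubmodule (Fin (m + 1)) K))
    (w : Fin (n + 1) → K) (u : Fin (m + 1) → K) :
    (∀ F ∈ graphEquations I f, eval u (map (eval w) F) = 0) ↔
      (∀ a ∈ I, eval u a = 0) ∧
        ∀ g, IsProportional I f g → ∀ i j, w i * eval u (g j) = w j * eval u (g i) := by
  have hC : ∀ a : MvPolynomial (Fin (m + 1)) K,
      map (eval w) (map (C : K →+* MvPolynomial (Fin (n + 1)) K) a) = a := fun a => by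
    rw [map_map]
    convert map_id a
    ext c
    simp
  constructor
  · intro h
    refine ⟨fun a ha => ?_, fun g hg i j => ?_⟩
    · rw [← sum_homogeneousComponent a, map_sum]
      refine Finset.sum_eq_zero fun e _ => ?_
      simpa only [hC] using h _ (Or.inl ⟨_, (mem_iff_homogeneousComponent_mem hIhom a).1 ha e,
        ⟨e, homogeneousComponent_isHomogeneous e a⟩, rfl⟩)
    · simpa [hC, sub_eq_zero] using h _ (Or.inr ⟨g, hg, i, j, rfl⟩)
  · rintro ⟨h1, h2⟩ F (⟨a, ha, -, rfl⟩ | ⟨g, hg, i, j, rfl⟩)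
    · rw [hC, h1 a ha]
    · simpa [hC, sub_eq_zero] using h2 g hg i j

variable [IsAlgClosed K]

theorem image_ofForms_subset (hI : I.IsPrime)
    (hIhom : I.IsHomogeneous (homogeneousSubmodule (Fin (m + 1)) K))
    (hf : ∀ i, (f i).IsHomogeneous d)
    (hne : (projV (I : Set (MvPolynomial (Fin (m + 1)) K)) \ projV (Set.range f)).Nonempty) :
    (PartialMorphism.ofForms _ f hf hne).image ⊆
      projV (imageIdeal I f : Set (MvPolynomial (Fin (n + 1)) K)) := by
  rintro _ ⟨ψ, hψ, p, hp, rfl⟩ g hg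
  induction p using Projectivization.ind with
  | h v hv =>
  have hv0 := (mk_mem_projV_iff hIhom v hv).1 (ψ.isOpen_dom.choose_spec.2.subset hp).1
  obtain ⟨h, hh, hne', heq⟩ := hψ.exists_forms hI hIhom hf hne hp
  rw [heq, vanishes_mk_iff_forall_smul]
  intro c _
  -- Since `g` need not be homogeneous, it has to vanish at every multiple of the coordinate vector;
  -- the scaled tuple `c h` is still proportional to `f`.
  have hmem : bind₁ (fun i => C c * h i) g ∈ I := by
    refine bind₁_mem_of_mem_imageIdeal hI (exists_notMem hne) hg fun i j => ?_
    rw [mul_assoc, mul_assoc, ← mul_sub]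
    exact I.mul_mem_left _ (hh.2 i j)
  have := hv0 _ hmem
  rw [eval_bind₁'] at this
  simp only [map_mul, eval_C] at this
  exact this

/-- Each form `g` among the equations of the closure vanishes on the values of `f`, so `g(f) ∈ I`
and `g` lies in the image ideal. -/
theorem projV_imageIdeal_subset (hI : I.IsPrime)
    (hIhom : I.IsHomogeneous (homogeneousSubmodule (Fin (m + 1)) K))
    (hf : ∀ i, (f i).IsHomogeneous d)
    (hne : (projV (I : Set (MvPolynomial (Fin (m + 1)) K)) \ projV (Set.range f)).Nonempty) :
    projV (imageIdeal I f : Set (MvPolynomial (Fin (n + 1)) K)) ⊆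
      closure (PartialMorphism.ofForms _ f hf hne).image := by
  obtain ⟨S, hS, hSZ⟩ := isClosed_iff.1
    (isClosed_closure (s := (PartialMorphism.ofForms _ f hf hne).image))
  rw [hSZ]
  intro q hq g hgS
  obtain ⟨e, he⟩ := hS g hgS
  refine hq g (mem_imageIdeal_of_bind₁_mem he ?_)
  obtain ⟨k, hk⟩ := exists_notMem hne
  have hmem : f k * bind₁ f g ∈ I := by
    refine mem_of_forall_eval_eq_zero hI (hne.mono Set.sdiff_subset)
      ((hf k).mul (bind₁_homog hf he)) fun v hv hvI => ?_
    rw [map_mul]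
    by_cases hkv : eval v (f k) = 0
    · rw [hkv, zero_mul]
    · have hfv : (fun i => eval v (f i)) ≠ 0 := Function.ne_iff.2 ⟨k, hkv⟩
      have hvf : Projectivization.mk K v hv ∉ projV (Set.range f) := fun h =>
        hkv (h _ ⟨k, rfl⟩ v hv rfl)
      have hval : formMap f (Projectivization.mk K v hv) ∈ projV S := by
        rw [← hSZ]
        exact subset_closure ⟨_, fun _ _ => rfl, _, ⟨(mk_mem_projV_iff hIhom v hv).2 hvI, hvf⟩, rfl⟩
      rw [formMap_mk hf v hv hfv] at hval
      rw [eval_bind₁', hval g hgS _ hfv rfl, mul_zero]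
  exact (hI.mem_or_mem hmem).resolve_left hk

/-- If the rational map is everywhere defined, its values are the points over which the graph
equations have a non-trivial solution. -/
theorem mk_mem_image_iff (hI : I.IsPrime)
    (hIhom : I.IsHomogeneous (homogeneousSubmodule (Fin (m + 1)) K))
    (hf : ∀ i, (f i).IsHomogeneous d)
    (hne : (projV (I : Set (MvPolynomial (Fin (m + 1)) K)) \ projV (Set.range f)).Nonempty)
    (hdom : (PartialMorphism.ofForms _ f hf hne).domainOfDefinition =
      projV (I : Set (MvPolynomial (Fin (m + 1)) K)))
    (w : Fin (n + 1) → K) (hw : w ≠ 0) :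
    Projectivization.mk K w hw ∈ (PartialMorphism.ofForms _ f hf hne).image ↔
      ∃ u : Fin (m + 1) → K, u ≠ 0 ∧ ∀ F ∈ graphEquations I f, eval u (map (eval w) F) = 0 := by
  simp only [forall_graphEquations_iff hIhom]
  constructor
  · rintro ⟨ψ, hψ, p, hp, hpw⟩
    induction p using Projectivization.ind with
    | h v hv =>
    have hv0 := (mk_mem_projV_iff hIhom v hv).1 (ψ.isOpen_dom.choose_spec.2.subset hp).1
    obtain ⟨h, hh, hne', heq⟩ := hψ.exists_forms hI hIhom hf hne hp
    obtain ⟨c, hc⟩ := (Projectivization.mk_eq_mk_iff' K _ _ _ _).1 (hpw.symm.trans heq)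
    -- Every other tuple `g` is proportional to `h` modulo `I`, so its equations hold at `v` even if
    -- `g` vanishes there.
    refine ⟨v, hv, hv0, fun g hg i j => ?_⟩
    have := hv0 _ (hh.mul_sub_mul_mem hI (exists_notMem hne) hg i j)
    rw [map_sub, map_mul, map_mul] at this
    simp only [← hc, Pi.smul_apply, smul_eq_mul]
    linear_combination c * this
  · rintro ⟨u, hu, huI, huw⟩
    have huX := (mk_mem_projV_iff hIhom u hu).2 huI
    rw [← hdom] at huX
    obtain ⟨ψ, hψ, hp⟩ := huX
    -- As `Φ` is defined at `u`, some tuple `h` is non-zero there, and its equations alone force `w`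
    -- to be the value at `u`.
    obtain ⟨h, hh, hne', heq⟩ := hψ.exists_forms hI hIhom hf hne hp
    refine ⟨ψ, hψ, _, hp, ?_⟩
    rw [heq, eq_comm, mk_eq_mk_iff_forall_mul_eq]
    exact huw h hh

theorem isClosed_image_ofForms (hI : I.IsPrime)
    (hIhom : I.IsHomogeneous (homogeneousSubmodule (Fin (m + 1)) K))
    (hf : ∀ i, (f i).IsHomogeneous d)
    (hne : (projV (I : Set (MvPolynomial (Fin (m + 1)) K)) \ projV (Set.range f)).Nonempty)
    (hdom : (PartialMorphism.ofForms _ f hf hne).domainOfDefinition =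
      projV (I : Set (MvPolynomial (Fin (m + 1)) K))) :
    IsClosed (PartialMorphism.ofForms _ f hf hne).image := by
  refine isClosed_of_closure_subset fun q hq => ?_
  by_contra hqIm
  induction q using Projectivization.ind with
  | h w hw =>
  rw [mk_mem_image_iff hI hIhom hf hne hdom] at hqIm
  push Not at hqIm
  obtain ⟨h, hhw, hh⟩ := exists_eval_ne_zero_of_forall_eq_zero (graphEquations I f)
    (fun F hF => isHomogeneous_of_mem_graphEquations hF) w fun p hp => by
      by_contra hp0
      obtain ⟨F, hF, hF0⟩ := hqIm p hp0
      exact hF0 (hp F hF)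
  -- Where `h ≠ 0` the graph equations have only the trivial solution, so no such point is a value;
  -- yet `h(w) ≠ 0` with `w` in the closure.
  have hsub : (PartialMorphism.ofForms _ f hf hne).image ⊆ projV {h} := by
    rintro q hq _ rfl v hv rfl
    obtain ⟨u, hu, huF⟩ := (mk_mem_image_iff hI hIhom hf hne hdom v hv).1 hq
    by_contra hv0
    exact hu (hh v hv0 u huF)
  exact hhw (closure_minimal hsub (isClosed_projV _) hq h rfl w hw rfl)

end

end RatMap

end

theorem mainTheorem1 {K : Type*} [Field K] [IsAlgClosed K] (m n : ℕ)
    (I : Ideal (MvPolynomial (Fin (m + 1)) K)) (hI : I.IsPrime)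
    (hIhom : I.IsHomogeneous (MvPolynomial.homogeneousSubmodule (Fin (m + 1)) K))
    (d : ℕ) (f : Fin (n + 1) → MvPolynomial (Fin (m + 1)) K)
    (hf : ∀ i, (f i).IsHomogeneous d)
    (hne : (RatMap.projV (I : Set (MvPolynomial (Fin (m + 1)) K)) \
      RatMap.projV (Set.range f)).Nonempty) :
    let X : Set (RatMap.PSpace K m) := RatMap.projV (I : Set (MvPolynomial (Fin (m + 1)) K))
    let Φ : RatMap.PartialMorphism X n := RatMap.PartialMorphism.ofForms X f hf hne
    closure Φ.image =
        RatMap.projV (RatMap.imageIdeal I f : Set (MvPolynomial (Fin (n + 1)) K)) ∧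
      (Φ.domainOfDefinition = X → IsClosed Φ.image) := by
  intro X Φ
  exact ⟨(closure_minimal (RatMap.image_ofForms_subset hI hIhom hf hne)
      (RatMap.isClosed_projV _)).antisymm (RatMap.projV_imageIdeal_subset hI hIhom hf hne),
    RatMap.isClosed_image_ofForms hI hIhom hf hne⟩
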